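/- Let $k$ be an algebraically closed field, and let $\mathcal{C}$ be a braided finite tensor category over $k$, that is, a rigid braided monoidal $k$-linear category with braiding $\sigma$ which is $k$-linearly equivalent to the category of finite-dimensional modules over some finite-dimensional $k$-algebra, whose tensor product is $k$-linear in each variable and whose unit object $\mathbf{1}$ is simple. For $X\in\mathcal{C}$ let $X^*$ be the left dual, with evaluation $\mathrm{ev}_X\colon X^*\otimes X\to\mathbf{1}$ (associators are suppressed below). Let $\mathbb{F}=\int^{X\in\mathcal{C}}X^*\otimes X$ be the coend, with universal dinatural transformation $i(X)\colon X^*\otimes X\to\mathbb{F}$, and let $\omega\colon\mathbb{F}\otimes\mathbb{F}\to\mathbf{1}$ be the unique morphism such that $$\omega\circ(i(X)\otimes i(Y))=(\mathrm{ev}_X\otimes\mathrm{ev}_Y)\circ(\mathrm{id}_{X^*}\otimes\sigma_{Y^*,X}\sigma_{X,Y^*}\otimes\mathrm{id}_Y)\qquad\text{for all }X,Y\in\mathcal{C}.$$ Define the $k$-linear map $$\Omega_{\mathcal{C}}\colon\mathrm{Hom}_{\mathcal{C}}(\mathbf{1},\mathbb{F})\to\mathrm{Hom}_{\mathcal{C}}(\mathbb{F},\mathbf{1}),\qquad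 f\mapsto\omega\circ(f\otimes\mathrm{id}_{\mathbb{F}}).$$ Let $\mathcal{C}'$ be the Müger center of $\mathcal{C}$, that is, the full subcategory of all objects $V$ with $\sigma_{V,X}\circ\sigma_{X,V}=\mathrm{id}_{X\otimes V}$ for all $X\in\mathcal{C}$, and let $$\Xi_{\mathcal{C}}=\{\xi\in\mathrm{End}(\mathrm{id}_{\mathcal{C}})\mid \xi_{V\otimes X}=\xi_V\otimes\mathrm{id}_X\text{ for all }V\in\mathcal{C}\text{ and }X\in\mathcal{C}'\},$$ a $k$-linear subspace of the space of natural endomorphisms of the identity functor of $\mathcal{C}$. Then $$\operatorname{rank}\Omega_{\mathcal{C}}\le\dim_k\Xi_{\mathcal{C}}.$$ -/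

import Mathlib

open CategoryTheory MonoidalCategory Limits Opposite

universe w v u

namespace FiniteTensor

noncomputable section

/-- A `k`-linear category is *finite abelian* if it is `k`-linearly equivalent to the category
of finite-dimensional modules over a finite-dimensional `k`-algebra `A`. (A finitely generated
`A`-module is the same thing as a finite-dimensional one, and every finite-dimensional algebra is
isomorphic to one whose carrier lives in the universe of `k`.) -/
class IsFiniteAbelian (k : Type w) [Field k] (C : Type u) [Category.{v} C] [Preadditive C]
    [Linear k C] : Prop where
  exists_equivalence : ∃ (A : Type w) (_ : Ring A) (_ : Algebra k A) (_ : Module.Finite k A)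
    (e : C ≌ FGModuleCat.{w} A), e.functor.Additive ∧ e.functor.Linear k

section Coend

variable {C : Type u} [Category.{v} C] [MonoidalCategory C] [RigidCategory C]

lemma mate_comp {X Y Z : C} (f : X ⟶ Y) (g : Y ⟶ Z) : (f ≫ g)ᘁ = gᘁ ≫ fᘁ :=
  comp_rightAdjointMate

variable (C) in
/-- The bifunctor `(X, Y) ↦ X* ⊗ Y`. The left dual `X*`, with evaluation
`X* ⊗ X ⟶ 𝟙` and coevaluation `𝟙 ⟶ X ⊗ X*`, is written `Xᘁ` (and called the right
dual) in Mathlib. -/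
@[simps]
def dualTensor : Cᵒᵖ ⥤ C ⥤ C where
  obj X := tensorLeft (X.unopᘁ)
  map f := { app := fun Y => (f.unopᘁ) ▷ Y
             naturality := fun Y Z g => by simp [whisker_exchange] }
  map_id X := by ext Y; simp
  map_comp f g := by ext Y; simp [mate_comp]

/-- Every object is a quotient of a finite power of a single object with finite-dimensional
endomorphism algebra. -/
lemma exists_generator (k : Type w) [Field k] (C : Type u) [Category.{v} C] [Preadditive C]
    [Linear k C] [h : IsFiniteAbelian k C] :
    ∃ P : C, Module.Finite k (P ⟶ P) ∧ ∀ X : C, ∃ (n : ℕ) (x : Fin n → (P ⟶ X)),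
      ∀ (Z : C) (g : X ⟶ Z), (∀ i, x i ≫ g = 0) → g = 0 := by
  obtain ⟨A, _, _, _, e, _, _⟩ := h.exists_equivalence
  have key : ∀ X : C, ∀ a : e.functor.obj X, ∃ f : e.inverse.obj (FGModuleCat.of A A) ⟶ X,
      (e.functor.map f).hom.hom.comp
        ((e.counitIso.app (FGModuleCat.of A A)).inv.hom.hom) = LinearMap.toSpanSingleton A _ a := by
    intro X a
    refine ⟨e.functor.preimage ((e.counitIso.app (FGModuleCat.of A A)).hom ≫
      FGModuleCat.ofHom (LinearMap.toSpanSingleton A _ a)), ?_⟩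
    rw [e.functor.map_preimage, ← FGModuleCat.hom_hom_comp, ← Category.assoc, Iso.inv_hom_id,
      Category.id_comp]
    rfl
  refine ⟨e.inverse.obj (FGModuleCat.of A A), ?_, fun X => ?_⟩
  · have hinj : Function.Injective (fun f : e.inverse.obj (FGModuleCat.of A A) ⟶
        e.inverse.obj (FGModuleCat.of A A) => (e.inverse.preimage f).hom.hom (1 : A)) := by
      intro f g hfg
      have h1 : e.inverse.preimage f = e.inverse.preimage g := by
        ext : 1
        exact LinearMap.ext_ring hfg
      simpa using congrArg e.inverse.map h1
    let L : (e.inverse.obj (FGModuleCat.of A A) ⟶ e.inverse.obj (FGModuleCat.of A A)) →ₗ[k] A :=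
      { toFun := fun f => (e.inverse.preimage f).hom.hom (1 : A)
        map_add' := fun f g => by
          have : e.inverse.preimage (f + g) = e.inverse.preimage f + e.inverse.preimage g :=
            e.inverse.map_injective (by simp [Functor.map_add])
          rw [this]; rfl
        map_smul' := fun c f => by
          have : e.inverse.preimage (c • f) = c • e.inverse.preimage f :=
            e.inverse.map_injective (by simp [Functor.map_smul])
          rw [this]
          change algebraMap k A c • (e.inverse.preimage f).hom.hom (1 : A) = _
          rw [algebraMap_smul]; rfl }
    exact Module.Finite.of_injective L hinj
  · obtain ⟨n, s, hs⟩ := Module.Finite.exists_fin (R := A) (M := e.functor.obj X)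
    choose f hf using key X
    refine ⟨n, fun i => f (s i), fun Z g hg => ?_⟩
    apply e.functor.map_injective
    rw [Functor.map_zero]
    ext : 1
    refine LinearMap.ext_on_range hs fun i => ?_
    have h2 : s i = (e.functor.map (f (s i))).hom.hom
        ((e.counitIso.app (FGModuleCat.of A A)).inv.hom.hom (1 : A)) := by
      have := LinearMap.congr_fun (hf (s i)) (1 : A)
      simpa using this.symm
    have h3 : (e.functor.map (f (s i)) ≫ e.functor.map g) = 0 := by
      rw [← Functor.map_comp, hg, Functor.map_zero]
    rw [h2]
    change ((e.functor.map (f (s i)) ≫ e.functor.map g)).hom.hom _ = 0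
    rw [h3]; rfl

lemma abelian_of_isFiniteAbelian (k : Type w) [Field k] (C : Type u) [Category.{v} C]
    [Preadditive C] [Linear k C] [h : IsFiniteAbelian k C] :
    HasFiniteProducts C ∧ HasKernels C ∧ HasCokernels C ∧ IsNormalEpiCategory C := by
  obtain ⟨A, _, _, _, e, _, _⟩ := h.exists_equivalence
  have : IsNoetherian k A := inferInstance
  have : IsNoetherianRing A := isNoetherian_of_tower k this
  have : HasFiniteProducts C :=
    ⟨fun n => Adjunction.hasLimitsOfShape_of_equivalence e.functor⟩
  let _ : Abelian C := abelianOfEquivalence e.functor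
  exact ⟨inferInstance, inferInstance, inferInstance, inferInstance⟩

/-- If `P` generates, morphisms out of `X` amount to `End P`-linear maps out of `Hom(P, X)`. -/
lemma exists_hom_of_generator {C : Type u} [Category.{v} C] [Preadditive C] [HasFiniteProducts C]
    [IsNormalEpiCategory C] {P : C} (hP : ∀ X : C, ∃ (n : ℕ) (x : Fin n → (P ⟶ X)),
      ∀ (Z : C) (g : X ⟶ Z), (∀ i, x i ≫ g = 0) → g = 0) {X Z : C}
    (θ : (P ⟶ X) →+ (P ⟶ Z)) (hθ : ∀ (g : P ⟶ P) (a : P ⟶ X), θ (g ≫ a) = g ≫ θ a) :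
    ∃ i : X ⟶ Z, ∀ a, a ≫ i = θ a := by
  have : HasFiniteBiproducts C := HasFiniteBiproducts.of_hasFiniteProducts
  have key : ∀ (n : ℕ) (x : Fin n → (P ⟶ X)),
      (∀ (Z : C) (g : X ⟶ Z), (∀ i, x i ≫ g = 0) → g = 0) →
      ∃ i : X ⟶ Z, ∀ j, x j ≫ i = θ (x j) := by
    intro n x hx
    let p : (⨁ fun _ : Fin n => P) ⟶ X := biproduct.desc x
    have : Epi p := Preadditive.epi_of_cancel_zero _ fun {Z} g hg => hx Z g fun i => by
      have := biproduct.ι (fun _ : Fin n => P) i ≫= hg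
      simpa [p] using this
    obtain ⟨W, g, w, hc⟩ := normalEpiOfEpi p
    have h0 : g ≫ biproduct.desc (fun j => θ (x j)) = 0 := by
      obtain ⟨m, y, hy⟩ := hP W
      refine hy _ _ fun l => ?_
      have h1 : ∀ {Y : C} (z : Fin n → (P ⟶ Y)), y l ≫ g ≫ biproduct.desc z =
          ∑ j, (y l ≫ g ≫ biproduct.π _ j) ≫ z j := by
        intro Y z
        rw [biproduct.desc_eq]
        simp [Preadditive.comp_sum]
      rw [h1]
      simp_rw [← hθ]
      rw [← map_sum, ← h1]
      change θ (y l ≫ g ≫ p) = 0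
      rw [w, comp_zero, map_zero]
    refine ⟨hc.desc (CokernelCofork.ofπ _ h0), fun j => ?_⟩
    have h2 := hc.fac (CokernelCofork.ofπ _ h0) WalkingParallelPair.one
    have h3 := biproduct.ι (fun _ : Fin n => P) j ≫= h2
    simpa [p] using h3
  obtain ⟨n, x, hx⟩ := hP X
  obtain ⟨i, hi⟩ := key n x hx
  refine ⟨i, fun a => ?_⟩
  obtain ⟨i', hi'⟩ := key (n + 1) (Fin.cons a x) fun Z g hg => hx Z g fun j => by
    simpa using hg j.succ
  have h4 : i' - i = 0 := hx _ _ fun j => by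
    have := hi' j.succ
    simp only [Fin.cons_succ] at this
    rw [Preadditive.comp_sub, this, hi, sub_self]
  have h5 := hi' 0
  simp only [Fin.cons_zero] at h5
  rw [← h5, sub_eq_zero.1 h4]

/-- The coend `∫^X X* ⊗ X` exists in a finite tensor category. -/
lemma hasCoend_dualTensor (k : Type w) [Field k] (C : Type u) [Category.{v} C] [Preadditive C]
    [Linear k C] [IsFiniteAbelian k C] [MonoidalCategory C] [MonoidalPreadditive C]
    [MonoidalLinear k C] [RigidCategory C] : HasCoend (dualTensor C) := by
  obtain ⟨_, _, _, _⟩ := abelian_of_isFiniteAbelian k C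
  have : HasFiniteBiproducts C := HasFiniteBiproducts.of_hasFiniteProducts
  obtain ⟨P, _, hP⟩ := exists_generator k C
  have mate_add : ∀ {X Y : C} (f g : X ⟶ Y), (f + g)ᘁ = fᘁ + gᘁ := fun f g => by
    simp [rightAdjointMate, MonoidalPreadditive.add_whiskerRight,
      MonoidalPreadditive.whiskerLeft_add]
  have mate_smul : ∀ {X Y : C} (c : k) (f : X ⟶ Y), (c • f)ᘁ = c • fᘁ := fun c f => by
    simp [rightAdjointMate]
  have mate_zero : ∀ {X Y : C}, (0 : X ⟶ Y)ᘁ = 0 := fun {X Y} => by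
    simp [rightAdjointMate]
  obtain ⟨m, s, hs⟩ := Module.Finite.exists_fin (R := k) (M := (P ⟶ P))
  let rel : (⨁ fun _ : Fin m => Pᘁ ⊗ P) ⟶ Pᘁ ⊗ P :=
    biproduct.desc fun j => (s j)ᘁ ▷ P - Pᘁ ◁ s j
  have hrel : ∀ j, biproduct.ι (fun _ : Fin m => Pᘁ ⊗ P) j ≫ rel = (s j)ᘁ ▷ P - Pᘁ ◁ s j :=
    fun j => biproduct.ι_desc _ _
  let π : Pᘁ ⊗ P ⟶ cokernel rel := cokernel.π rel
  have hπ : ∀ g : P ⟶ P, gᘁ ▷ P ≫ π = Pᘁ ◁ g ≫ π := by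
    intro g
    have hg : g ∈ Submodule.span k (Set.range s) := by rw [hs]; trivial
    induction hg using Submodule.span_induction with
    | mem g hg =>
      obtain ⟨j, rfl⟩ := hg
      have := biproduct.ι (fun _ : Fin m => Pᘁ ⊗ P) j ≫= cokernel.condition rel
      rwa [← Category.assoc, hrel, comp_zero, Preadditive.sub_comp, sub_eq_zero] at this
    | zero => simp [mate_zero]
    | add a b _ _ ha hb =>
      simp [mate_add, ha, hb, MonoidalPreadditive.add_whiskerRight,
        MonoidalPreadditive.whiskerLeft_add]
    | smul c a _ ha => simp [mate_smul, ha]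
  have hepi : ∀ (X : C) {Y Z : C} (f g : Xᘁ ⊗ Y ⟶ Z),
      (∀ a : P ⟶ Y, Xᘁ ◁ a ≫ f = Xᘁ ◁ a ≫ g) → f = g := by
    intro X Y Z f g hfg
    apply (tensorLeftHomEquiv Y X Xᘁ Z).injective
    obtain ⟨n, x, hx⟩ := hP Y
    rw [← sub_eq_zero]
    refine hx _ _ fun i => ?_
    rw [Preadditive.comp_sub, sub_eq_zero]
    apply (tensorLeftHomEquiv P X Xᘁ Z).symm.injective
    rw [tensorLeftHomEquiv_symm_naturality, tensorLeftHomEquiv_symm_naturality]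
    simpa using hfg (x i)
  have hi : ∀ X : C, ∃ i : Xᘁ ⊗ X ⟶ cokernel rel,
      ∀ a : P ⟶ X, Xᘁ ◁ a ≫ i = aᘁ ▷ P ≫ π := by
    intro X
    let e := tensorLeftHomEquiv P X Xᘁ (cokernel rel)
    obtain ⟨i, hi⟩ := exists_hom_of_generator hP
      (X := X) (Z := X ⊗ cokernel rel)
      { toFun := fun a => e (aᘁ ▷ P ≫ π)
        map_zero' := by simp [mate_zero, e, tensorLeftHomEquiv]
        map_add' := fun a b => by
          simp [mate_add, e, tensorLeftHomEquiv, MonoidalPreadditive.add_whiskerRight,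
            MonoidalPreadditive.whiskerLeft_add] } (fun g a => by
        change e _ = g ≫ e _
        apply e.symm.injective
        rw [tensorLeftHomEquiv_symm_naturality]
        simp only [Equiv.symm_apply_apply, e, mate_comp, comp_whiskerRight, Category.assoc, hπ]
        rw [whisker_exchange_assoc])
    refine ⟨(tensorLeftHomEquiv X X Xᘁ _).symm i, fun a => ?_⟩
    rw [← tensorLeftHomEquiv_symm_naturality, hi]
    exact e.symm_apply_apply _
  choose i hi using hi
  have hdin : ∀ ⦃X Y : C⦄ (f : X ⟶ Y), fᘁ ▷ X ≫ i X = Yᘁ ◁ f ≫ i Y := by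
    intro X Y f
    apply hepi Y
    intro a
    rw [whisker_exchange_assoc, hi, ← MonoidalCategory.whiskerLeft_comp_assoc, hi, mate_comp,
      comp_whiskerRight, Category.assoc]
  have hiP : i P = π := by simpa using hi P (𝟙 P)
  have hdesc : ∀ (Z : C) (t : ∀ X : C, Xᘁ ⊗ X ⟶ Z),
      (∀ ⦃X Y : C⦄ (f : X ⟶ Y), fᘁ ▷ X ≫ t X = Yᘁ ◁ f ≫ t Y) →
      ∃ d : cokernel rel ⟶ Z, ∀ X, i X ≫ d = t X := by
    intro Z t ht
    refine ⟨cokernel.desc rel (t P) ?_, fun X => ?_⟩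
    · refine biproduct.hom_ext' _ _ fun j => ?_
      rw [← Category.assoc, hrel, comp_zero, Preadditive.sub_comp, sub_eq_zero]
      exact ht (s j)
    · apply hepi X
      intro a
      rw [← Category.assoc, hi, Category.assoc, cokernel.π_desc]
      exact ht a
  have huniq : ∀ (Z : C) (d d' : cokernel rel ⟶ Z), (∀ X, i X ≫ d = i X ≫ d') → d = d' := by
    intro Z d d' h
    apply (cancel_epi (cokernel.π rel)).1
    have := h P
    rwa [hiP] at this
  choose d hd using fun (E : Cowedge (dualTensor C)) =>
    hdesc E.pt (fun X => E.π X) (fun X Y f => Cowedge.condition E f)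
  exact ⟨⟨⟨Cowedge.mk (F := dualTensor C) (cokernel rel) i hdin,
    Multicofork.IsColimit.mk _ d (fun E X => hd E X)
      (fun E m hm => huniq _ _ _ fun X => (hm X).trans (hd E X).symm)⟩⟩⟩

end Coend

section HopfPairing

variable (k : Type w) [Field k] (C : Type u) [Category.{v} C] [Preadditive C] [Linear k C]
  [IsFiniteAbelian k C] [MonoidalCategory C] [MonoidalPreadditive C] [MonoidalLinear k C]
  [RigidCategory C]

/-- The coend `𝔽 = ∫^X X* ⊗ X`. -/
def coendF : C :=
  have := hasCoend_dualTensor k C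
  coend (dualTensor C)

variable {C}

/-- The component `i(X) : X* ⊗ X ⟶ 𝔽` of the universal dinatural transformation. -/
def coendι (X : C) : Xᘁ ⊗ X ⟶ coendF k C :=
  have := hasCoend_dualTensor k C
  coend.ι (dualTensor C) X

lemma coendι_dinatural {X Y : C} (f : X ⟶ Y) : fᘁ ▷ X ≫ coendι k X = Yᘁ ◁ f ≫ coendι k Y :=
  have := hasCoend_dualTensor k C
  coend.condition (dualTensor C) f

lemma coendF_hom_ext {Z : C} {f g : coendF k C ⟶ Z} (h : ∀ X, coendι k X ≫ f = coendι k X ≫ g) :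
    f = g :=
  have := hasCoend_dualTensor k C
  coend.hom_ext h

lemma coendF_exists_desc {Z : C} (t : ∀ X : C, Xᘁ ⊗ X ⟶ Z)
    (ht : ∀ ⦃X Y : C⦄ (f : X ⟶ Y), fᘁ ▷ X ≫ t X = Yᘁ ◁ f ≫ t Y) :
    ∃ d : coendF k C ⟶ Z, ∀ X, coendι k X ≫ d = t X :=
  have := hasCoend_dualTensor k C
  ⟨coend.desc (F := dualTensor C) t ht, fun X => coend.ι_desc (F := dualTensor C) t ht X⟩

lemma whiskerRight_coendι_ext {A Z : C} {f g : coendF k C ⊗ A ⟶ Z}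
    (h : ∀ X : C, coendι k X ▷ A ≫ f = coendι k X ▷ A ≫ g) : f = g := by
  apply (tensorRightHomEquiv _ A Aᘁ Z).injective
  refine coendF_hom_ext k fun X => ?_
  apply (tensorRightHomEquiv _ A Aᘁ Z).symm.injective
  rw [tensorRightHomEquiv_symm_naturality, tensorRightHomEquiv_symm_naturality]
  simpa using h X

lemma whiskerLeft_coendι_ext {A Z : C} {f g : A ⊗ coendF k C ⟶ Z}
    (h : ∀ X : C, A ◁ coendι k X ≫ f = A ◁ coendι k X ≫ g) : f = g := by
  apply (tensorLeftHomEquiv _ (ᘁA) A Z).injective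
  refine coendF_hom_ext k fun X => ?_
  apply (tensorLeftHomEquiv _ (ᘁA) A Z).symm.injective
  rw [tensorLeftHomEquiv_symm_naturality, tensorLeftHomEquiv_symm_naturality]
  simpa using h X

lemma exists_whiskerRight_desc {A Z : C} (t : ∀ X : C, (Xᘁ ⊗ X) ⊗ A ⟶ Z)
    (ht : ∀ ⦃X Y : C⦄ (f : X ⟶ Y), (fᘁ ▷ X) ▷ A ≫ t X = (Yᘁ ◁ f) ▷ A ≫ t Y) :
    ∃ d : coendF k C ⊗ A ⟶ Z, ∀ X, coendι k X ▷ A ≫ d = t X := by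
  obtain ⟨d, hd⟩ := coendF_exists_desc k
    (fun X : C => tensorRightHomEquiv ((Xᘁ : C) ⊗ X) A (Aᘁ : C) Z (t X))
    fun X Y f => by
      apply (tensorRightHomEquiv _ A Aᘁ Z).symm.injective
      rw [tensorRightHomEquiv_symm_naturality, tensorRightHomEquiv_symm_naturality]
      simpa using ht f
  refine ⟨(tensorRightHomEquiv _ A Aᘁ Z).symm d, fun X => ?_⟩
  rw [← tensorRightHomEquiv_symm_naturality, hd]
  exact Equiv.symm_apply_apply _ _

lemma exists_whiskerLeft_desc {A Z : C} (t : ∀ X : C, A ⊗ (Xᘁ ⊗ X) ⟶ Z)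
    (ht : ∀ ⦃X Y : C⦄ (f : X ⟶ Y), A ◁ (fᘁ ▷ X) ≫ t X = A ◁ (Yᘁ ◁ f) ≫ t Y) :
    ∃ d : A ⊗ coendF k C ⟶ Z, ∀ X, A ◁ coendι k X ≫ d = t X := by
  obtain ⟨d, hd⟩ := coendF_exists_desc k
    (fun X : C => tensorLeftHomEquiv ((Xᘁ : C) ⊗ X) (ᘁA : C) A Z (t X))
    fun X Y f => by
      apply (tensorLeftHomEquiv _ (ᘁA) A Z).symm.injective
      rw [tensorLeftHomEquiv_symm_naturality, tensorLeftHomEquiv_symm_naturality]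
      simpa using ht f
  refine ⟨(tensorLeftHomEquiv _ (ᘁA) A Z).symm d, fun X => ?_⟩
  rw [← tensorLeftHomEquiv_symm_naturality, hd]
  exact Equiv.symm_apply_apply _ _

section Pairing

variable {C : Type u} [Category.{v} C] [MonoidalCategory C] [BraidedCategory C]

lemma monodromy_naturality {X X' U U' Y Y' : C} (f : X ⟶ X') (g : U ⟶ U') (h : Y ⟶ Y') :
    (f ⊗ₘ (g ⊗ₘ h)) ≫ (α_ X' U' Y').inv ≫ ((β_ X' U').hom ≫ (β_ U' X').hom) ▷ Y' ≫
        (α_ X' U' Y').hom =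
      ((α_ X U Y).inv ≫ ((β_ X U).hom ≫ (β_ U X).hom) ▷ Y ≫ (α_ X U Y).hom) ≫
        (f ⊗ₘ (g ⊗ₘ h)) := by
  have hσ : (f ⊗ₘ g) ≫ (β_ X' U').hom ≫ (β_ U' X').hom =
      ((β_ X U).hom ≫ (β_ U X).hom) ≫ (f ⊗ₘ g) := by
    rw [BraidedCategory.braiding_naturality_assoc, BraidedCategory.braiding_naturality,
      Category.assoc]
  rw [associator_inv_naturality_assoc, Category.assoc, Category.assoc, ← associator_naturality,
    ← tensorHom_id, ← tensorHom_id, tensorHom_comp_tensorHom_assoc,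
    tensorHom_comp_tensorHom_assoc, hσ, Category.comp_id, Category.id_comp]

variable [RigidCategory C]

/-- The morphism `(ev_X ⊗ ev_Y) ∘ (id_{X*} ⊗ σ_{Y*,X} σ_{X,Y*} ⊗ id_Y)`, associators included. -/
def pairingComponent (X Y : C) : (Xᘁ ⊗ X) ⊗ (Yᘁ ⊗ Y) ⟶ 𝟙_ C :=
  (α_ Xᘁ X (Yᘁ ⊗ Y)).hom ≫
    Xᘁ ◁ ((α_ X Yᘁ Y).inv ≫ ((β_ X Yᘁ).hom ≫ (β_ Yᘁ X).hom) ▷ Y ≫ (α_ X Yᘁ Y).hom) ≫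
      (α_ Xᘁ X (Yᘁ ⊗ Y)).inv ≫ (ε_ X Xᘁ ⊗ₘ ε_ Y Yᘁ) ≫ (λ_ (𝟙_ C)).hom

lemma pairingComponent_dinatural_left {X X' : C} (f : X ⟶ X') (Y : C) :
    (fᘁ ▷ X) ▷ (Yᘁ ⊗ Y) ≫ pairingComponent X Y =
      (X'ᘁ ◁ f) ▷ (Yᘁ ⊗ Y) ≫ pairingComponent X' Y := by
  have h := monodromy_naturality f (𝟙 (Yᘁ : C)) (𝟙 Y)
  simp only [tensorHom_id, id_whiskerRight] at h
  unfold pairingComponent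
  rw [associator_naturality_left_assoc, associator_naturality_middle_assoc,
    ← whisker_exchange_assoc, ← MonoidalCategory.whiskerLeft_comp_assoc (X'ᘁ : C) (f ▷ _), h,
    MonoidalCategory.whiskerLeft_comp_assoc _ _ (f ▷ _), associator_inv_naturality_left_assoc,
    associator_inv_naturality_middle_assoc, whiskerRight_comp_tensorHom_assoc,
    whiskerRight_comp_tensorHom_assoc, rightAdjointMate_comp_evaluation]

lemma pairingComponent_dinatural_right (X : C) {Y Y' : C} (f : Y ⟶ Y') :
    (Xᘁ ⊗ X) ◁ (fᘁ ▷ Y) ≫ pairingComponent X Y =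
      (Xᘁ ⊗ X) ◁ (Y'ᘁ ◁ f) ≫ pairingComponent X Y' := by
  have h1 := monodromy_naturality (𝟙 X) (fᘁ) (𝟙 Y)
  have h2 := monodromy_naturality (𝟙 X) (𝟙 (Y'ᘁ : C)) f
  simp only [tensorHom_id, id_tensorHom] at h1 h2
  unfold pairingComponent
  rw [associator_naturality_right_assoc, associator_naturality_right_assoc,
    ← MonoidalCategory.whiskerLeft_comp_assoc, ← MonoidalCategory.whiskerLeft_comp_assoc, h1, h2,
    MonoidalCategory.whiskerLeft_comp_assoc _ _ (X ◁ fᘁ ▷ Y),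
    MonoidalCategory.whiskerLeft_comp_assoc _ _ (X ◁ Y'ᘁ ◁ f),
    associator_inv_naturality_right_assoc, associator_inv_naturality_right_assoc,
    whiskerLeft_comp_tensorHom_assoc, whiskerLeft_comp_tensorHom_assoc,
    rightAdjointMate_comp_evaluation]

end Pairing

variable [BraidedCategory C]

variable (C) in
/-- The universal property of the coend gives a unique morphism `ω : 𝔽 ⊗ 𝔽 ⟶ 𝟙` with
`ω ∘ (i(X) ⊗ i(Y)) = (ev_X ⊗ ev_Y) ∘ (id_{X*} ⊗ σ_{Y*,X} σ_{X,Y*} ⊗ id_Y)` for all `X`, `Y`. -/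
lemma existsUnique_pairing :
    ∃! ω : coendF k C ⊗ coendF k C ⟶ 𝟙_ C, ∀ X Y : C,
      (coendι k X ⊗ₘ coendι k Y) ≫ ω = pairingComponent X Y := by
  choose ψ hψ using fun Y : C => exists_whiskerRight_desc k (A := Yᘁ ⊗ Y)
    (fun X => pairingComponent X Y) (fun _ _ f => pairingComponent_dinatural_left f Y)
  obtain ⟨ω, hω⟩ := exists_whiskerLeft_desc k ψ (fun Y Y' f => whiskerRight_coendι_ext k
    fun X => by
      rw [← whisker_exchange_assoc, ← whisker_exchange_assoc, hψ, hψ]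
      exact pairingComponent_dinatural_right X f)
  refine ⟨ω, fun X Y => ?_, fun ω' h => ?_⟩
  · rw [MonoidalCategory.tensorHom_def, Category.assoc, hω, hψ]
  · refine whiskerLeft_coendι_ext k fun Y => whiskerRight_coendι_ext k fun X => ?_
    have h1 := h X Y
    rw [MonoidalCategory.tensorHom_def, Category.assoc] at h1
    rw [h1, hω, hψ]

variable (C)

/-- The Hopf pairing `ω : 𝔽 ⊗ 𝔽 ⟶ 𝟙`. -/
def hopfPairing : coendF k C ⊗ coendF k C ⟶ 𝟙_ C :=
  (existsUnique_pairing k C).choose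

lemma hopfPairing_spec (X Y : C) :
    (coendι k X ⊗ₘ coendι k Y) ≫ hopfPairing k C = pairingComponent X Y :=
  (existsUnique_pairing k C).choose_spec.1 X Y

/-- The space `CE(C) = Hom(𝔽, 𝟙)` of central elements. -/
abbrev CE : Type v := coendF k C ⟶ 𝟙_ C

/-- The space `CF(C) = Hom(𝟙, 𝔽)` of class functions. -/
abbrev CF : Type v := 𝟙_ C ⟶ coendF k C

/-- The linear map `Ω : CF(C) → CE(C)`, `f ↦ ω ∘ (f ⊗ id_𝔽)`. -/
def Omega : CF k C →ₗ[k] CE k C where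
  toFun f := (λ_ (coendF k C)).inv ≫ f ▷ coendF k C ≫ hopfPairing k C
  map_add' f g := by simp [MonoidalPreadditive.add_whiskerRight]
  map_smul' c f := by simp

end HopfPairing

section MugerCenter

variable {C : Type u} [Category.{v} C] [MonoidalCategory C] [BraidedCategory C]

/-- The Müger centralizer of a full subcategory `D`: the objects `V` with
`σ_{V,X} ∘ σ_{X,V} = id_{X ⊗ V}` for all `X` in `D`. -/
def mugerCentralizer (D : ObjectProperty C) : ObjectProperty C :=
  fun V => ∀ X : C, D X → (β_ X V).hom ≫ (β_ V X).hom = 𝟙 (X ⊗ V)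

variable (C) in
/-- The Müger center `C'`: the Müger centralizer of `C` in itself. -/
def mugerCenter : ObjectProperty C := mugerCentralizer ⊤

/-- The space `Ξ` of natural endomorphisms `ξ` of the identity functor of `C` such that
`ξ_{V ⊗ X} = ξ_V ⊗ id_X` for all `V` in `C` and all `X` in the Müger center. -/
def Xi (k : Type w) [Field k] (C : Type u) [Category.{v} C] [Preadditive C] [Linear k C]
    [MonoidalCategory C] [MonoidalPreadditive C] [MonoidalLinear k C] [BraidedCategory C] :
    Submodule k (𝟭 C ⟶ 𝟭 C) where
  carrier := {ξ | ∀ V X : C, mugerCenter C X → ξ.app (V ⊗ X) = ξ.app V ▷ X}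
  zero_mem' V X _ := by simp
  add_mem' {a b} ha hb V X hX := by
    simp [ha V X hX, hb V X hX, MonoidalPreadditive.add_whiskerRight]
  smul_mem' c a ha V X hX := by simp [ha V X hX]

end MugerCenter

end

end FiniteTensor

namespace FiniteTensor

/-! By duality and the universal property of the coend, `Hom(𝔽, 𝟙)` embeds linearly into the natural
endomorphisms of the identity functor (`centralEnd_injective`), so it suffices that the image of `Ω`
lands in `Ξ`.

The double braiding makes `𝔽` act on every object, so a class function `f` gives a natural
endomorphism of the identity functor, `classFunctionApp`. Transparent tensor factors are invisible
to the double braiding, so this endomorphism acts only on the remaining factor, whichever side the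
transparent one is on. The Hopf pairing is this action on `Y*` followed by evaluation
(`pairingComponent_eq`), so the endomorphism of `Y` attached to `Ω f` is the transpose of the action
of `f` on `Y*`. Since `X*⊗ V*` is dual to `V ⊗ X` and `X*` is transparent when `X` is, transposing
gives the defining condition of `Ξ` (`centralApp_Omega_tensor`). -/

lemma hom_ext_evaluation {C : Type u} [Category.{v} C] [MonoidalCategory C] {X Y : C}
    [HasRightDual Y] {f g : X ⟶ Y} (h : Yᘁ ◁ f ≫ ε_ Y Yᘁ = Yᘁ ◁ g ≫ ε_ Y Yᘁ) : f = g := by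
  rw [← cancel_mono (ρ_ Y).inv]
  apply (tensorLeftHomEquiv X Y Yᘁ (𝟙_ C)).symm.injective
  simpa [tensorLeftHomEquiv, unitors_equal] using h

/-! ### Double braidings and transparent objects. -/

section Monodromy

variable {C : Type u} [Category.{v} C] [MonoidalCategory C] [BraidedCategory C]

/-- The double braiding `σ_{V,X} ∘ σ_{X,V}` of `X ⊗ V`. -/
def monodromy (X V : C) : X ⊗ V ⟶ X ⊗ V := (β_ X V).hom ≫ (β_ V X).hom

lemma monodromy_naturality_left {X Y : C} (f : X ⟶ Y) (V : C) :
    f ▷ V ≫ monodromy Y V = monodromy X V ≫ f ▷ V := by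
  simp [monodromy]

lemma monodromy_naturality_right (X : C) {V W : C} (f : V ⟶ W) :
    X ◁ f ≫ monodromy X W = monodromy X V ≫ X ◁ f := by
  simp [monodromy]

lemma monodromy_tensorUnit (X : C) : monodromy X (𝟙_ C) = 𝟙 _ := by
  simp [monodromy]

lemma mem_mugerCenter_iff (V : C) : mugerCenter C V ↔ ∀ X : C, monodromy X V = 𝟙 (X ⊗ V) :=
  ⟨fun h X => h X trivial, fun h X _ => h X⟩

/-- Transparent right factors do not contribute to the double braiding. -/
lemma monodromy_tensor_of_mem_mugerCenter (X V : C) {W : C} (hW : mugerCenter C W) :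
    monodromy X (V ⊗ W) = (α_ X V W).inv ≫ monodromy X V ▷ W ≫ (α_ X V W).hom := by
  have h := (mem_mugerCenter_iff W).1 hW X
  rw [monodromy] at h
  rw [monodromy, monodromy, BraidedCategory.braiding_tensor_right_hom,
    BraidedCategory.braiding_tensor_left_hom]
  simp only [Category.assoc, Iso.inv_hom_id_assoc]
  -- After both hexagons the two braidings of `X` with `W` are adjacent in the middle, so
  -- transparency cancels them.
  rw [← MonoidalCategory.whiskerLeft_comp_assoc V, h]
  simp

/-- Naturality along `X* ⊗ X ⟶ 𝟙` and triviality on the unit show that evaluation absorbs the double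
braiding of `Z` with `X* ⊗ X`. As `X` is transparent, only the part at `X*` remains, and the duality
adjunction removes the evaluation. -/
lemma mugerCenter_rightDual {X : C} [HasRightDual X] (hX : mugerCenter C X) :
    mugerCenter C Xᘁ := by
  refine (mem_mugerCenter_iff _).2 fun Z => ?_
  apply (tensorRightHomEquiv (Z ⊗ Xᘁ) X Xᘁ Z).symm.injective
  have h := monodromy_naturality_right Z (ε_ X Xᘁ)
  rw [monodromy_tensorUnit, Category.comp_id, monodromy_tensor_of_mem_mugerCenter _ _ hX] at h
  have h' := (α_ Z (Xᘁ) X).hom ≫= h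
  simp only [Category.assoc, Iso.hom_inv_id_assoc] at h'
  simp [tensorRightHomEquiv, ← reassoc_of% h']

end Monodromy

/-! ### The action of `X* ⊗ X` by double braiding. -/

section Action

variable {C : Type u} [Category.{v} C] [MonoidalCategory C] [BraidedCategory C] [RigidCategory C]

/-- The morphism `(ev_X ⊗ id_U) ∘ (id_{X*} ⊗ σ_{U,X} σ_{X,U})`. -/
def actionComponent (X U : C) : (Xᘁ ⊗ X) ⊗ U ⟶ U :=
  (α_ Xᘁ X U).hom ≫ Xᘁ ◁ monodromy X U ≫ (α_ Xᘁ X U).inv ≫ ε_ X Xᘁ ▷ U ≫ (λ_ U).hom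

lemma actionComponent_dinatural {X Y : C} (f : X ⟶ Y) (U : C) :
    (fᘁ ▷ X) ▷ U ≫ actionComponent X U = (Yᘁ ◁ f) ▷ U ≫ actionComponent Y U := by
  unfold actionComponent
  rw [associator_naturality_left_assoc, associator_naturality_middle_assoc,
    ← whisker_exchange_assoc, ← MonoidalCategory.whiskerLeft_comp_assoc (Yᘁ : C) (f ▷ _),
    monodromy_naturality_left, MonoidalCategory.whiskerLeft_comp_assoc,
    associator_inv_naturality_left_assoc, associator_inv_naturality_middle_assoc,
    ← comp_whiskerRight_assoc, ← comp_whiskerRight_assoc, rightAdjointMate_comp_evaluation]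

lemma actionComponent_naturality (X : C) {U V : C} (g : U ⟶ V) :
    (Xᘁ ⊗ X) ◁ g ≫ actionComponent X V = actionComponent X U ≫ g := by
  unfold actionComponent
  rw [associator_naturality_right_assoc, ← MonoidalCategory.whiskerLeft_comp_assoc,
    monodromy_naturality_right, MonoidalCategory.whiskerLeft_comp_assoc,
    associator_inv_naturality_right_assoc, whisker_exchange_assoc]
  simp

lemma actionComponent_tensor (X V : C) {W : C} (hW : mugerCenter C W) :
    actionComponent X (V ⊗ W) = (α_ (Xᘁ ⊗ X) V W).inv ≫ actionComponent X V ▷ W := by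
  unfold actionComponent
  rw [monodromy_tensor_of_mem_mugerCenter _ _ hW]
  monoidal

/-- The double braiding in the pairing only involves `X` and `Y*`, so evaluating on `X` first leaves
the action on `Y*`, to be paired with `Y`. -/
lemma pairingComponent_eq (X Y : C) :
    pairingComponent X Y =
      (α_ (Xᘁ ⊗ X) Yᘁ Y).inv ≫ actionComponent X Yᘁ ▷ Y ≫ ε_ Y Yᘁ := by
  unfold pairingComponent actionComponent
  rw [← monodromy, MonoidalCategory.tensorHom_def]
  have h : (𝟙_ C) ◁ ε_ Y Yᘁ ≫ (λ_ (𝟙_ C)).hom = (λ_ _).hom ≫ ε_ Y Yᘁ := by simp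
  rw [Category.assoc, h]
  monoidal

end Action

/-! ### The action of the coend, and class functions as natural endomorphisms. -/

section CoendAction

variable (k : Type w) [Field k] {C : Type u} [Category.{v} C] [Preadditive C] [Linear k C]
  [IsFiniteAbelian k C] [MonoidalCategory C] [MonoidalPreadditive C] [MonoidalLinear k C]
  [RigidCategory C] [BraidedCategory C]

/-- The action of the coend on the object `U`. -/
noncomputable def coendAction (U : C) : coendF k C ⊗ U ⟶ U :=
  (exists_whiskerRight_desc k (fun X => actionComponent X U)
    fun _ _ f => actionComponent_dinatural f U).choose

lemma coendι_whiskerRight_coendAction (X U : C) :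
    coendι k X ▷ U ≫ coendAction k U = actionComponent X U :=
  (exists_whiskerRight_desc k (fun X => actionComponent X U)
    fun _ _ f => actionComponent_dinatural f U).choose_spec X

lemma coendAction_naturality {U V : C} (g : U ⟶ V) :
    coendF k C ◁ g ≫ coendAction k V = coendAction k U ≫ g :=
  whiskerRight_coendι_ext k fun X => by
    rw [← whisker_exchange_assoc, coendι_whiskerRight_coendAction, actionComponent_naturality,
      ← Category.assoc, coendι_whiskerRight_coendAction]

lemma coendAction_tensor (V : C) {W : C} (hW : mugerCenter C W) :
    coendAction k (V ⊗ W) = (α_ (coendF k C) V W).inv ≫ coendAction k V ▷ W :=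
  whiskerRight_coendι_ext k fun X => by
    rw [coendι_whiskerRight_coendAction, actionComponent_tensor _ _ hW,
      associator_inv_naturality_left_assoc, ← comp_whiskerRight, coendι_whiskerRight_coendAction]

lemma whiskerLeft_coendι_hopfPairing (Y : C) :
    coendF k C ◁ coendι k Y ≫ hopfPairing k C =
      (α_ (coendF k C) Yᘁ Y).inv ≫ coendAction k Yᘁ ▷ Y ≫ ε_ Y Yᘁ :=
  whiskerRight_coendι_ext k fun X => by
    have h := hopfPairing_spec k C X Y
    rw [MonoidalCategory.tensorHom_def, Category.assoc] at h
    rw [h, pairingComponent_eq, associator_inv_naturality_left_assoc, ← comp_whiskerRight_assoc,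
      coendι_whiskerRight_coendAction]

/-- The endomorphism of `U` by which a class function `f : 𝟙 ⟶ 𝔽` acts. -/
noncomputable def classFunctionApp (f : CF k C) (U : C) : U ⟶ U :=
  (λ_ U).inv ≫ f ▷ U ≫ coendAction k U

lemma classFunctionApp_naturality (f : CF k C) {U V : C} (g : U ⟶ V) :
    g ≫ classFunctionApp k f V = classFunctionApp k f U ≫ g := by
  simp only [classFunctionApp, Category.assoc]
  rw [leftUnitor_inv_naturality_assoc, whisker_exchange_assoc, coendAction_naturality]

lemma classFunctionApp_tensor_right (f : CF k C) (V : C) {W : C} (hW : mugerCenter C W) :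
    classFunctionApp k f (V ⊗ W) = classFunctionApp k f V ▷ W := by
  simp [classFunctionApp, coendAction_tensor k V hW]

/-- Conjugating by the braiding moves the transparent factor to the right. The left-hand version is
needed because dualizing `V ⊗ X` reverses the factors. -/
lemma classFunctionApp_tensor_left (f : CF k C) (V : C) {W : C} (hW : mugerCenter C W) :
    classFunctionApp k f (W ⊗ V) = W ◁ classFunctionApp k f V := by
  rw [← cancel_mono (β_ W V).hom, ← classFunctionApp_naturality,
    classFunctionApp_tensor_right k f V hW, BraidedCategory.braiding_naturality_right]

/-- This identifies `Ω f` at `Y` with the transpose of the action of `f` on `Y*`. -/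
lemma coendι_comp_Omega (f : CF k C) (Y : C) :
    coendι k Y ≫ Omega k C f = classFunctionApp k f Yᘁ ▷ Y ≫ ε_ Y Yᘁ := by
  change coendι k Y ≫ (λ_ (coendF k C)).inv ≫ f ▷ coendF k C ≫ hopfPairing k C = _
  rw [leftUnitor_inv_naturality_assoc, whisker_exchange_assoc, whiskerLeft_coendι_hopfPairing]
  simp [classFunctionApp]

end CoendAction

/-! ### Central elements as natural endomorphisms, and the image of `Ω`. -/

section CentralElements

variable (k : Type w) [Field k] {C : Type u} [Category.{v} C] [Preadditive C] [Linear k C]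
  [IsFiniteAbelian k C] [MonoidalCategory C] [MonoidalPreadditive C] [MonoidalLinear k C]
  [RigidCategory C]

/-- The endomorphism of `Y` corresponding to `φ ∘ i(Y)`. -/
noncomputable def centralApp (φ : CE k C) (Y : C) : Y ⟶ Y :=
  tensorLeftHomEquiv Y Y Yᘁ (𝟙_ C) (coendι k Y ≫ φ) ≫ (ρ_ Y).hom

lemma whiskerLeft_centralApp_evaluation (φ : CE k C) (Y : C) :
    Yᘁ ◁ centralApp k φ Y ≫ ε_ Y Yᘁ = coendι k Y ≫ φ := by
  have h := (tensorLeftHomEquiv Y Y Yᘁ (𝟙_ C)).symm_apply_apply (coendι k Y ≫ φ)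
  rw [← h]
  simp [centralApp, tensorLeftHomEquiv, unitors_equal]

/-- Dinaturality of the coend inclusions becomes naturality after transposing. -/
lemma centralApp_naturality (φ : CE k C) {X Y : C} (f : X ⟶ Y) :
    f ≫ centralApp k φ Y = centralApp k φ X ≫ f := by
  apply hom_ext_evaluation
  rw [MonoidalCategory.whiskerLeft_comp_assoc, whiskerLeft_centralApp_evaluation,
    MonoidalCategory.whiskerLeft_comp_assoc, ← rightAdjointMate_comp_evaluation,
    whisker_exchange_assoc, whiskerLeft_centralApp_evaluation, ← Category.assoc,
    ← coendι_dinatural, Category.assoc]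

variable (C) in
/-- Central elements act as natural endomorphisms of the identity functor. -/
noncomputable def centralEnd : CE k C →ₗ[k] (𝟭 C ⟶ 𝟭 C) where
  toFun φ :=
    { app := fun Y => centralApp k φ Y
      naturality := fun _ _ f => centralApp_naturality k φ f }
  map_add' φ ψ := by
    ext Y
    apply hom_ext_evaluation
    simp [MonoidalPreadditive.whiskerLeft_add, whiskerLeft_centralApp_evaluation]
  map_smul' c φ := by
    ext Y
    apply hom_ext_evaluation
    simp [whiskerLeft_centralApp_evaluation]

lemma centralEnd_app (φ : CE k C) (Y : C) : (centralEnd k C φ).app Y = centralApp k φ Y := rfl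

lemma centralEnd_injective : Function.Injective (centralEnd k C) := fun φ ψ h =>
  coendF_hom_ext k fun X => by
    rw [← whiskerLeft_centralApp_evaluation, ← whiskerLeft_centralApp_evaluation,
      ← centralEnd_app, h, centralEnd_app]

variable [BraidedCategory C]

/-- The actions of `f` and of `Ω f` are adjoint with respect to every pairing. -/
lemma whiskerLeft_centralApp_Omega (f : CF k C) {W Y : C} (p : W ⊗ Y ⟶ 𝟙_ C) :
    W ◁ centralApp k (Omega k C f) Y ≫ p = classFunctionApp k f W ▷ Y ≫ p := by
  -- Every pairing is pulled back from the evaluation along some `h`, and the action of `f` commutes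
  -- with `h`.
  obtain ⟨h, rfl⟩ : ∃ h : W ⟶ Yᘁ, p = h ▷ Y ≫ ε_ Y Yᘁ := by
    refine ⟨tensorRightHomEquiv W Y Yᘁ (𝟙_ C) p ≫ (λ_ _).hom, ?_⟩
    conv_lhs => rw [← (tensorRightHomEquiv W Y Yᘁ (𝟙_ C)).symm_apply_apply p]
    generalize tensorRightHomEquiv W Y Yᘁ (𝟙_ C) p = q
    simp [tensorRightHomEquiv, ← unitors_equal]
  rw [whisker_exchange_assoc, whiskerLeft_centralApp_evaluation,
    coendι_comp_Omega, ← comp_whiskerRight_assoc, ← comp_whiskerRight_assoc,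
    classFunctionApp_naturality]

/-- Adjointness holds for every pairing, so `V ⊗ X` can be paired with `X* ⊗ V*` by nested
evaluations, with no comparison to the chosen dual of `V ⊗ X`. -/
lemma centralApp_Omega_tensor (f : CF k C) (V : C) {X : C} (hX : mugerCenter C X) :
    centralApp k (Omega k C f) (V ⊗ X) = centralApp k (Omega k C f) V ▷ X := by
  let q : (Vᘁ : C) ⊗ (V ⊗ X) ⟶ X := (α_ _ _ _).inv ≫ ε_ V Vᘁ ▷ X ≫ (λ_ X).hom
  have key := whiskerLeft_centralApp_Omega k f (W := (Xᘁ : C) ⊗ Vᘁ) (Y := V ⊗ X)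
    ((α_ _ _ _).hom ≫ Xᘁ ◁ q ≫ ε_ X Xᘁ)
  have hq : Vᘁ ◁ (centralApp k (Omega k C f) V ▷ X) ≫ q =
      classFunctionApp k f Vᘁ ▷ (V ⊗ X) ≫ q := by
    simp only [q]
    rw [associator_inv_naturality_middle_assoc, associator_inv_naturality_left_assoc,
      ← comp_whiskerRight_assoc, ← comp_whiskerRight_assoc, whiskerLeft_centralApp_Omega]
  rw [classFunctionApp_tensor_left k f _ (mugerCenter_rightDual hX),
    associator_naturality_right_assoc, associator_naturality_middle_assoc, cancel_epi,
    ← MonoidalCategory.whiskerLeft_comp_assoc, ← MonoidalCategory.whiskerLeft_comp_assoc,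
    ← hq] at key
  -- The evaluation of `X` is stripped off first, leaving an equality after the partial evaluation
  -- `q`.
  have h := hom_ext_evaluation key
  -- The adjunct of `q` is the identity of `V ⊗ X`, so `q` can be cancelled as well.
  have hid : tensorLeftHomEquiv _ V Vᘁ X q = 𝟙 _ := by
    rw [← Equiv.eq_symm_apply]
    simp [tensorLeftHomEquiv, q]
  have : Mono (tensorLeftHomEquiv _ V Vᘁ X q) := hid ▸ inferInstance
  apply (cancel_mono (tensorLeftHomEquiv _ V Vᘁ X q)).1
  apply (tensorLeftHomEquiv _ V Vᘁ X).symm.injective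
  rw [tensorLeftHomEquiv_symm_naturality, tensorLeftHomEquiv_symm_naturality,
    Equiv.symm_apply_apply, h]

end CentralElements

end FiniteTensor

theorem proposition5p6 (k : Type w) [Field k] [IsAlgClosed k]
    (C : Type u) [Category.{v} C] [Preadditive C] [Linear k C]
    [FiniteTensor.IsFiniteAbelian k C]
    [MonoidalCategory C] [MonoidalPreadditive C] [MonoidalLinear k C]
    [RigidCategory C] [Simple (𝟙_ C)] [BraidedCategory C] :
    Cardinal.lift.{max u v} (LinearMap.rank (FiniteTensor.Omega k C)) ≤
      Cardinal.lift.{v} (Module.rank k (FiniteTensor.Xi k C)) := by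
  -- An injection bounds the ranks as cardinals, so no finiteness of dimension has to be shown. The
  -- lifts reconcile the universes of the two spaces.
  refine LinearMap.lift_rank_le_of_injective
    (((FiniteTensor.centralEnd k C).domRestrict
      (LinearMap.range (FiniteTensor.Omega k C))).codRestrict (FiniteTensor.Xi k C) ?_) ?_
  · rintro ⟨_, f, rfl⟩ V X hX
    exact FiniteTensor.centralApp_Omega_tensor k f V hX
  · intro a b h
    exact Subtype.ext (FiniteTensor.centralEnd_injective k (congrArg Subtype.val h))
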